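/- Let $R\subseteq S$ be an extension of commutative unital rings, and let $[R,S]$ be the poset of $R$-subalgebras of $S$, ordered by inclusion. Assume that the extension has FCP, i.e. every chain in $[R,S]$ is finite. For an $R$-module $E$, let $\mathrm{MSupp}_R(E)$ be the set of maximal ideals $M$ of $R$ with $E_M\neq 0$. For a maximal ideal $M$ of $R$ and $T\in[R,S]$, write $T_M$ for the localization of $T$ at $R\setminus M$, regarded as an $R_M$-subalgebra of $S_M$. The extension $R\subseteq S$ is called a $\mathcal B$-extension if the map $$[R,S]\longrightarrow\prod_{M\in\mathrm{MSupp}_R(S/R)}[R_M,S_M],\qquad T\longmapsto (T_M)_M$$ is bijective. For $X\subseteq\mathrm{MSupp}_R(S/R)$, a splitter of the extension at $X$ is an element $T\in[R,S]$ such that $\mathrm{MSupp}_R(T/R)=X$ and $\mathrm{MSupp}_R(S/T)=\mathrm{MSupp}_R(S/R)\setminus X$. Then $R\subseteq S$ is a $\mathcal B$-extension if and only if, for every subset $X\subseteq\mathrm{MSupp}_R(S/R)$, there exists a splitter of the extension at $X$. -/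

import Mathlib

namespace RingExt

universe u v

section

variable {R : Type u} {S : Type v} [CommRing R] [CommRing S] [Algebra R S]

/-- The extension `R ⊆ S` has FCP: every chain in the poset `[R, S]` of all `R`-subalgebras of `S`
is finite. -/
def HasFCP (R : Type u) (S : Type v) [CommRing R] [CommRing S] [Algebra R S] : Prop :=
  ∀ C : Set (Subalgebra R S), IsChain (· ≤ ·) C → C.Finite

/-- The maximal support `MSupp_R(E) = Supp_R(E) ∩ Max(R)` of an `R`-module `E`. -/
def MSupp (R : Type u) (E : Type v) [CommRing R] [AddCommGroup E] [Module R E] :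
    Set (MaximalSpectrum R) :=
  {M | M.toPrimeSpectrum ∈ Module.support R E}

/-- The `R`-module `S/R`, i.e. `S` modulo the image of `R`. For `T ∈ [R, S]`, the `R`-module `T/R`
is `OverBase R T`. -/
abbrev OverBase (R : Type u) (S : Type v) [CommRing R] [CommRing S] [Algebra R S] : Type v :=
  S ⧸ Subalgebra.toSubmodule (⊥ : Subalgebra R S)

/-- `S_P`, the localization of the ring `S` at the image of `R ∖ P`. It is an algebra over
`R_P = Localization.AtPrime P`. -/
abbrev LocAt (S : Type v) [CommRing S] [Algebra R S] (P : Ideal R) [P.IsPrime] : Type v :=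
  Localization (Algebra.algebraMapSubmonoid S P.primeCompl)

/-- The fraction `t / s` in `S_P`, where `t ∈ S` and `s ∈ R ∖ P`. -/
noncomputable def frac (P : Ideal R) [P.IsPrime] (t : S) (s : P.primeCompl) : LocAt S P :=
  Localization.mk t ⟨algebraMap R S s, Algebra.mem_algebraMapSubmonoid_of_mem s⟩

/-- For `T ∈ [R, S]`, the element `T_P` of `[R_P, S_P]`: the subalgebra of all fractions `t / s`
with `t ∈ T` and `s ∈ R ∖ P`. -/
noncomputable def localize (P : Ideal R) [P.IsPrime] (T : Subalgebra R S) :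
    Subalgebra (Localization.AtPrime P) (LocAt S P) where
  carrier := {x | ∃ t ∈ T, ∃ s : P.primeCompl, x = frac P t s}
  mul_mem' := by
    rintro _ _ ⟨t, ht, s, rfl⟩ ⟨t', ht', s', rfl⟩
    refine ⟨t * t', T.mul_mem ht ht', s * s', ?_⟩
    simp only [frac, Localization.mk_mul]
    congr 1
    ext
    simp
  add_mem' := by
    rintro _ _ ⟨t, ht, s, rfl⟩ ⟨t', ht', s', rfl⟩
    refine ⟨algebraMap R S s * t' + algebraMap R S s' * t,
      T.add_mem (T.mul_mem (T.algebraMap_mem _) ht') (T.mul_mem (T.algebraMap_mem _) ht),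
      s * s', ?_⟩
    simp only [frac, Localization.add_mk]
    congr 1
    ext
    simp
  algebraMap_mem' := by
    intro r
    obtain ⟨a, s, rfl⟩ := IsLocalization.exists_mk'_eq P.primeCompl r
    refine ⟨algebraMap R S a, T.algebraMap_mem _, s, ?_⟩
    rw [IsLocalization.algebraMap_mk' (S := S), frac, Localization.mk_eq_mk']

/-- `R ⊆ S` is a `𝓑`-extension: the map `[R, S] → ∏_{M ∈ MSupp(S/R)} [R_M, S_M]`,
`T ↦ (T_M)_M`, is bijective. -/
def IsBExtension (R : Type u) (S : Type v) [CommRing R] [CommRing S] [Algebra R S] : Prop :=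
  Function.Bijective
    (fun (T : Subalgebra R S) (M : MSupp R (OverBase R S)) =>
      (localize M.1.asIdeal T :
        Subalgebra (Localization.AtPrime M.1.asIdeal) (LocAt S M.1.asIdeal)))

/-- `T ∈ [R, S]` is a splitter of `R ⊆ S` at `X ⊆ MSupp(S/R)`: `MSupp_R(T/R) = X` and
`MSupp_R(S/T)` is the complement of `X` in `MSupp_R(S/R)`. -/
def IsSplitter (T : Subalgebra R S) (X : Set (MaximalSpectrum R)) : Prop :=
  MSupp R (OverBase R T) = X ∧
    MSupp R (S ⧸ Subalgebra.toSubmodule T) = MSupp R (OverBase R S) \ X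

end

end RingExt

namespace RingExt

section

variable {R : Type*} {S : Type*} [CommRing R] [CommRing S] [Algebra R S]

/-! The map `T ↦ (T_M)` is always injective, because inclusion of subalgebras is a local property
(`le_of_forall_localize_le`), so only surjectivity is at stake. A splitter at `X` is exactly a
preimage of the family equal to `⊤` on `X` and `⊥` off `X` (`isSplitter_iff`), so surjectivity
yields splitters. Conversely, splitters `V M` at singletons suffice: given a family `U`, cutting `V
M` down by the preimage of `U M` gives a subalgebra equal to `U M` at `M` and trivial at the other
points of the support. The supremum of these subalgebras realizes `U`. -/

/-! ### Fractions and localized subalgebras -/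

theorem mem_localize {P : Ideal R} [P.IsPrime] {T : Subalgebra R S} {x : LocAt S P} :
    x ∈ localize P T ↔ ∃ t ∈ T, ∃ s : P.primeCompl, x = frac P t s :=
  Iff.rfl

theorem exists_eq_frac (P : Ideal R) [P.IsPrime] (x : LocAt S P) :
    ∃ (t : S) (s : P.primeCompl), x = frac P t s := by
  induction x using Localization.induction_on with
  | H y =>
    obtain ⟨t, ⟨_, s, hs, rfl⟩⟩ := y
    exact ⟨t, ⟨s, hs⟩, rfl⟩

theorem frac_mul_left (P : Ideal R) [P.IsPrime] (t : S) (r s : P.primeCompl) :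
    frac P ((r : R) • t) (r * s) = frac P t s := by
  rw [frac, frac, Localization.mk_eq_mk_iff, Localization.r_iff_exists]
  refine ⟨1, ?_⟩
  simp only [Algebra.smul_def, Submonoid.coe_mul, map_mul, OneMemClass.coe_one]
  ring

theorem exists_smul_eq_of_frac_eq {P : Ideal R} [P.IsPrime] {t t' : S} {s s' : P.primeCompl}
    (h : frac P t s = frac P t' s') :
    ∃ r r' : P.primeCompl, (r : R) • t = (r' : R) • t' := by
  rw [frac, frac, Localization.mk_eq_mk_iff, Localization.r_iff_exists] at h
  obtain ⟨⟨_, u, hu, rfl⟩, h⟩ := h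
  refine ⟨⟨u, hu⟩ * s', ⟨u, hu⟩ * s, ?_⟩
  simp only [Algebra.smul_def, Submonoid.coe_mul, map_mul]
  simpa only [mul_assoc] using h

theorem smul_frac (P : Ideal R) [P.IsPrime] (r : R) (s' : P.primeCompl) (t : S)
    (s : P.primeCompl) :
    Localization.mk r s' • frac P t s = frac P (r • t) (s' * s) := by
  rw [Algebra.smul_def, Localization.mk_eq_mk', IsLocalization.algebraMap_mk' (S := S),
    ← Localization.mk_eq_mk', frac, frac, Localization.mk_mul]
  congr 1
  · rw [Algebra.smul_def]
  · ext
    simp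

theorem frac_mem_localize_iff {P : Ideal R} [P.IsPrime] {T : Subalgebra R S} {t : S}
    {s : P.primeCompl} :
    frac P t s ∈ localize P T ↔ ∃ r : P.primeCompl, (r : R) • t ∈ T := by
  constructor
  · rintro ⟨t', ht', s', h⟩
    obtain ⟨r, r', h⟩ := exists_smul_eq_of_frac_eq h
    exact ⟨r, h ▸ T.smul_mem ht' _⟩
  · rintro ⟨r, hr⟩
    exact ⟨_, hr, r * s, (frac_mul_left P t r s).symm⟩

theorem localize_le_localize_iff {P : Ideal R} [P.IsPrime] {T T' : Subalgebra R S} :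
    localize P T ≤ localize P T' ↔ ∀ t ∈ T, ∃ r : P.primeCompl, (r : R) • t ∈ T' := by
  constructor
  · exact fun h t ht => frac_mem_localize_iff.1 (h ⟨t, ht, 1, rfl⟩)
  · rintro h _ ⟨t, ht, s, rfl⟩
    exact frac_mem_localize_iff.2 (h t ht)

theorem localize_mono (P : Ideal R) [P.IsPrime] {T T' : Subalgebra R S} (h : T ≤ T') :
    localize P T ≤ localize P T' :=
  localize_le_localize_iff.2 fun t ht => ⟨1, T'.smul_mem (h ht) _⟩

theorem localize_top (P : Ideal R) [P.IsPrime] : localize P (⊤ : Subalgebra R S) = ⊤ := by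
  refine top_le_iff.1 fun x _ => ?_
  obtain ⟨t, s, rfl⟩ := exists_eq_frac P x
  exact ⟨t, Algebra.mem_top, s, rfl⟩

theorem localize_bot (P : Ideal R) [P.IsPrime] : localize P (⊥ : Subalgebra R S) = ⊥ := by
  refine le_bot_iff.1 ?_
  rintro _ ⟨t, ht, s, rfl⟩
  obtain ⟨a, rfl⟩ := Algebra.mem_bot.1 ht
  refine Algebra.mem_bot.2 ⟨IsLocalization.mk' _ a s, ?_⟩
  rw [IsLocalization.algebraMap_mk' (S := S), frac, Localization.mk_eq_mk']

/-- Denominators are units of the base ring `R_P`, so they do not affect membership. -/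
theorem frac_one_mem_iff {P : Ideal R} [P.IsPrime]
    {U : Subalgebra (Localization.AtPrime P) (LocAt S P)} {t : S} {s : P.primeCompl} :
    frac P t 1 ∈ U ↔ frac P t s ∈ U := by
  constructor <;> intro h
  · have := U.smul_mem h (Localization.mk 1 s)
    rwa [smul_frac, one_smul, mul_one] at this
  · have := U.smul_mem h (Localization.mk (s : R) 1)
    rwa [smul_frac, one_mul, ← frac_mul_left P t s 1, mul_one] at *

/-- The preimage in `S` of a subalgebra of `S_P`. -/
noncomputable def contract (P : Ideal R) [P.IsPrime]
    (U : Subalgebra (Localization.AtPrime P) (LocAt S P)) : Subalgebra R S where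
  carrier := {t | frac P t 1 ∈ U}
  mul_mem' := by
    intro t t' ht ht'
    have := U.mul_mem ht ht'
    rw [frac, frac, Localization.mk_mul] at this
    change frac P (t * t') 1 ∈ U
    convert this using 1
    rw [frac]
    congr 1
    ext
    simp
  add_mem' := by
    intro t t' ht ht'
    have := U.add_mem ht ht'
    rw [frac, frac, Localization.add_mk] at this
    change frac P (t + t') 1 ∈ U
    convert this using 1
    rw [frac]
    congr 1
    · simp [add_comm]
    · ext
      simp
  algebraMap_mem' := by
    intro r
    have h : frac P (algebraMap R S r) 1 ∈ localize P (⊥ : Subalgebra R S) :=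
      ⟨_, Subalgebra.algebraMap_mem _ r, 1, rfl⟩
    rw [localize_bot] at h
    exact bot_le (a := U) h

theorem mem_contract {P : Ideal R} [P.IsPrime]
    {U : Subalgebra (Localization.AtPrime P) (LocAt S P)} {t : S} :
    t ∈ contract P U ↔ frac P t 1 ∈ U :=
  Iff.rfl

/-- This Galois connection bounds the localization of a supremum without describing the supremum's
elements. -/
theorem localize_le_iff {P : Ideal R} [P.IsPrime] {T : Subalgebra R S}
    {U : Subalgebra (Localization.AtPrime P) (LocAt S P)} :
    localize P T ≤ U ↔ T ≤ contract P U := by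
  constructor
  · exact fun h t ht => h ⟨t, ht, 1, rfl⟩
  · rintro h _ ⟨t, ht, s, rfl⟩
    exact frac_one_mem_iff.1 (h ht)

/-- The factor `V` costs nothing at `P`; its role is to control the subalgebra at the other maximal
ideals. -/
theorem localize_inf_contract {P : Ideal R} [P.IsPrime] {V : Subalgebra R S}
    (hV : localize P V = ⊤) (U : Subalgebra (Localization.AtPrime P) (LocAt S P)) :
    localize P (V ⊓ contract P U) = U := by
  refine le_antisymm (localize_le_iff.2 inf_le_right) fun x hx => ?_
  obtain ⟨t, ht, s, rfl⟩ : x ∈ localize P V := hV ▸ trivial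
  exact ⟨t, ⟨ht, frac_one_mem_iff.2 hx⟩, s, rfl⟩

/-! ### Supports, splitters and the local-global principle -/

theorem notMem_MSupp_quotient_iff {E : Type*} [AddCommGroup E] [Module R E] {N : Submodule R E}
    {M : MaximalSpectrum R} :
    M ∉ MSupp R (E ⧸ N) ↔ ∀ e : E, ∃ r : M.asIdeal.primeCompl, (r : R) • e ∈ N := by
  rw [MSupp, Set.mem_ofPred_eq, Module.notMem_support_iff']
  constructor
  · intro h e
    obtain ⟨r, hr, h⟩ := h (N.mkQ e)
    refine ⟨⟨r, hr⟩, ?_⟩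
    rwa [← map_smul, Submodule.mkQ_apply, Submodule.Quotient.mk_eq_zero] at h
  · intro h e
    obtain ⟨e, rfl⟩ := N.mkQ_surjective e
    obtain ⟨r, hr⟩ := h e
    refine ⟨r, r.2, ?_⟩
    rwa [← map_smul, Submodule.mkQ_apply, Submodule.Quotient.mk_eq_zero]

theorem notMem_MSupp_quotient_iff_localize_eq_top {T : Subalgebra R S} {M : MaximalSpectrum R} :
    M ∉ MSupp R (S ⧸ Subalgebra.toSubmodule T) ↔ localize M.asIdeal T = ⊤ := by
  rw [notMem_MSupp_quotient_iff, ← top_le_iff, ← localize_top, localize_le_localize_iff]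
  simp

theorem notMem_MSupp_overBase_iff_localize_eq_bot {T : Subalgebra R S} {M : MaximalSpectrum R} :
    M ∉ MSupp R (OverBase R T) ↔ localize M.asIdeal T = ⊥ := by
  rw [notMem_MSupp_quotient_iff, ← le_bot_iff, ← localize_bot,
    localize_le_localize_iff, Subtype.forall]
  simp only [Subalgebra.mem_toSubmodule, Algebra.mem_bot, Set.mem_range, Subtype.ext_iff]
  rfl

theorem localize_eq_bot_of_notMem_MSupp {M : MaximalSpectrum R}
    (hM : M ∉ MSupp R (OverBase R S)) (T : Subalgebra R S) : localize M.asIdeal T = ⊥ := by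
  refine le_bot_iff.1 (le_top.trans_eq ?_)
  rw [← notMem_MSupp_quotient_iff_localize_eq_top.1 hM, localize_bot]

theorem le_of_forall_localize_le {T T' : Subalgebra R S}
    (h : ∀ M ∈ MSupp R (OverBase R S), localize M.asIdeal T ≤ localize M.asIdeal T') :
    T ≤ T' := by
  intro t ht
  by_contra hne
  -- `I` is the conductor `{r | r • t ∈ T'}`. If proper, it lies in some maximal `M`, whereas `T_M ≤
  -- T'_M` gives an element of `I` outside `M`.
  let I : Ideal R := (Subalgebra.toSubmodule T').comap (LinearMap.toSpanSingleton R S t)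
  have hI : I ≠ ⊤ := fun hI => hne <| by
    have h1 : (1 : R) ∈ I := hI ▸ Submodule.mem_top
    simpa [I] using h1
  obtain ⟨M, hM, hIM⟩ := Ideal.exists_le_maximal I hI
  have hle : localize M T ≤ localize M T' := by
    by_cases hS : (⟨M, hM⟩ : MaximalSpectrum R) ∈ MSupp R (OverBase R S)
    · exact h _ hS
    · exact (localize_eq_bot_of_notMem_MSupp hS T).trans_le bot_le
  obtain ⟨r, hr⟩ := localize_le_localize_iff.1 hle t ht
  exact r.2 (hIM (by simpa [I] using hr))

/-- Off `MSupp R (OverBase R S)` one has `⊥ = ⊤`, so neither support contains such an `M`; `hX`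
makes this consistent with `X`. -/
theorem isSplitter_iff {T : Subalgebra R S} {X : Set (MaximalSpectrum R)}
    (hX : X ⊆ MSupp R (OverBase R S)) :
    IsSplitter T X ↔ ∀ M ∈ MSupp R (OverBase R S),
      (localize M.asIdeal T = ⊥ ↔ M ∉ X) ∧ (localize M.asIdeal T = ⊤ ↔ M ∈ X) := by
  simp only [← notMem_MSupp_overBase_iff_localize_eq_bot,
    ← notMem_MSupp_quotient_iff_localize_eq_top, not_iff_not]
  constructor
  · rintro ⟨h1, h2⟩ M hM
    rw [h1, h2]
    simp [hM]
  · intro h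
    constructor <;> ext M
    · by_cases hM : M ∈ MSupp R (OverBase R S)
      · exact (h M hM).1
      · have := notMem_MSupp_overBase_iff_localize_eq_bot.2
          (localize_eq_bot_of_notMem_MSupp hM T)
        exact iff_of_false this fun hMX => hM (hX hMX)
    · by_cases hM : M ∈ MSupp R (OverBase R S)
      · rw [Set.mem_sdiff, and_iff_right hM, ← (h M hM).2, not_not]
      · refine iff_of_false (notMem_MSupp_quotient_iff_localize_eq_top.2 ?_) fun hM' => hM hM'.1
        rw [localize_eq_bot_of_notMem_MSupp hM, ← localize_eq_bot_of_notMem_MSupp hM ⊤,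
          localize_top]

/-! ### Injectivity, and the two implications -/

theorem localize_family_injective :
    Function.Injective (fun (T : Subalgebra R S) (M : MSupp R (OverBase R S)) =>
      (localize M.1.asIdeal T :
        Subalgebra (Localization.AtPrime M.1.asIdeal) (LocAt S M.1.asIdeal))) := by
  intro T T' h
  have h' (M) (hM : M ∈ MSupp R (OverBase R S)) :
      localize M.asIdeal T = localize M.asIdeal T' := congrFun h ⟨M, hM⟩
  exact le_antisymm (le_of_forall_localize_le fun M hM => (h' M hM).le)
    (le_of_forall_localize_le fun M hM => (h' M hM).ge)

theorem bot_ne_top_of_mem_MSupp {M : MaximalSpectrum R} (hM : M ∈ MSupp R (OverBase R S)) :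
    (⊥ : Subalgebra (Localization.AtPrime M.asIdeal) (LocAt S M.asIdeal)) ≠ ⊤ := by
  rw [← localize_bot]
  exact fun h => notMem_MSupp_quotient_iff_localize_eq_top.2 h hM

theorem IsBExtension.exists_isSplitter (h : IsBExtension R S) {X : Set (MaximalSpectrum R)}
    (hX : X ⊆ MSupp R (OverBase R S)) : ∃ T : Subalgebra R S, IsSplitter T X := by
  classical
  obtain ⟨T, hT⟩ := h.2 fun M => if M.1 ∈ X then ⊤ else ⊥
  refine ⟨T, (isSplitter_iff hX).2 fun M hM => ?_⟩
  have hTM : localize M.asIdeal T = if M ∈ X then ⊤ else ⊥ := congrFun hT ⟨M, hM⟩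
  -- Without `⊥ ≠ ⊤`, the value of `T_M` would not determine whether `M ∈ X`.
  have hne := bot_ne_top_of_mem_MSupp hM
  rw [hTM]
  split_ifs with hMX <;> simp [hMX, hne, hne.symm]

theorem isBExtension_of_exists_isSplitter_singleton
    (h : ∀ M ∈ MSupp R (OverBase R S), ∃ T : Subalgebra R S, IsSplitter T {M}) :
    IsBExtension R S := by
  refine ⟨localize_family_injective, fun U => ?_⟩
  choose V hV using fun M : MSupp R (OverBase R S) => h M.1 M.2
  have hV' (M : MSupp R (OverBase R S)) :=
    (isSplitter_iff (Set.singleton_subset_iff.2 M.2)).1 (hV M)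
  let W (M : MSupp R (OverBase R S)) : Subalgebra R S := V M ⊓ contract M.1.asIdeal (U M)
  have hW (M) : localize M.1.asIdeal (W M) = U M :=
    localize_inf_contract ((hV' M M.1 M.2).2.2 rfl) (U M)
  refine ⟨⨆ M, W M, funext fun N => le_antisymm ?_ ?_⟩
  · refine localize_le_iff.2 (iSup_le fun M => localize_le_iff.1 ?_)
    by_cases hMN : M = N
    · subst hMN
      exact (hW M).le
    · have hbot : localize N.1.asIdeal (V M) = ⊥ :=
        (hV' M N.1 N.2).1.2 fun hNM => hMN (Subtype.ext hNM.symm)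
      exact (localize_mono _ inf_le_left).trans (hbot.trans_le bot_le)
  · exact (hW N).ge.trans (localize_mono _ (le_iSup W N))

end

end RingExt

theorem theorem1p15 {R : Type*} {S : Type*} [CommRing R] [CommRing S] [Algebra R S]
    (hinj : Function.Injective (algebraMap R S)) (hFCP : RingExt.HasFCP R S) :
    RingExt.IsBExtension R S ↔
      ∀ X : Set (MaximalSpectrum R), X ⊆ RingExt.MSupp R (RingExt.OverBase R S) →
        ∃ T : Subalgebra R S, RingExt.IsSplitter T X :=
  ⟨fun h _ hX => h.exists_isSplitter hX, fun h =>
    RingExt.isBExtension_of_exists_isSplitter_singleton fun _ hM =>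
      h _ (Set.singleton_subset_iff.2 hM)⟩
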